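/- Let $\mathcal A$ be a unital $C^*$-algebra, let $\mathcal H$ be a separable complex Hilbert space, and let $S_{\mathcal H}(\mathcal A)$ be the set of unital completely positive (UCP) maps $\mathcal A\to\mathcal B(\mathcal H)$. A map $\phi\in S_{\mathcal H}(\mathcal A)$ is called $C^*$-extreme if, whenever $\phi(\cdot)=\sum_{i=1}^n T_i^*\phi_i(\cdot)T_i$ with $\phi_i\in S_{\mathcal H}(\mathcal A)$ and invertible $T_i\in\mathcal B(\mathcal H)$ satisfying $\sum_{i=1}^n T_i^*T_i=I_{\mathcal H}$, then for each $i$ there is a unitary $U_i\in\mathcal B(\mathcal H)$ with $\phi_i(\cdot)=U_i^*\phi(\cdot)U_i$. A minimal Stinespring triple $(\pi,V,\mathcal H_\pi)$ for $\phi$ consists of a Hilbert space $\mathcal H_\pi$, a unital $*$-homomorphism $\pi:\mathcal A\to\mathcal B(\mathcal H_\pi)$ and a bounded operator $V:\mathcal H\to\mathcal H_\pi$ such that $\phi(a)=V^*\pi(a)V$ for all $a\in\mathcal A$ and the closed linear span of $\pi(\mathcal A)V\mathcal H$ is $\mathcal H_\pi$. Write $\pi(\mathcal A)'$ for the commutant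 of $\pi(\mathcal A)$ in $\mathcal B(\mathcal H_\pi)$. A (not necessarily self-adjoint) subalgebra $\mathcal M$ of a $C^*$-algebra $\mathcal B$ has factorization in $\mathcal B$ if for every positive invertible $D\in\mathcal B$ there is an invertible $S$ with $S,S^{-1}\in\mathcal M$ and $D=S^*S$. Let $\phi$ be a $C^*$-extreme point of $S_{\mathcal H}(\mathcal A)$ with minimal Stinespring triple $(\pi,V,\mathcal H_\pi)$. Then for every positive invertible operator $D\in\pi(\mathcal A)'$ there exists an operator $S$ that is invertible in $\pi(\mathcal A)'$ such that $D=S^*S$, $SVV^*=VV^*SVV^*$, and $V^*SV$ is invertible with inverse $V^*S^{-1}V$. In particular, the algebra $$\mathcal M=\{T\in\pi(\mathcal A)' : TVV^*=VV^*TVV^*\}$$ has factorization in $\pi(\mathcal A)'$. -/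

import Mathlib

/-- The generalized state space `S_H(A)`: the set of unital completely positive maps from the
unital C⋆-algebra `A` to the C⋆-algebra of bounded operators on `H`. -/
def generalizedStateSpace (A : Type*) [CStarAlgebra A] [PartialOrder A] [StarOrderedRing A]
    (H : Type*) [NormedAddCommGroup H] [InnerProductSpace ℂ H] [CompleteSpace H] :
    Set (CompletelyPositiveMap A (H →L[ℂ] H)) :=
  {φ | φ 1 = 1}

/-- `φ` is a C⋆-extreme point of `S_H(A)`: it is a unital completely positive map, and whenever
`φ = ∑ Tᵢ⋆ φᵢ(·) Tᵢ` is a proper C⋆-convex combination of unital completely positive maps `φᵢ`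
(the `Tᵢ` are invertible and `∑ Tᵢ⋆ Tᵢ = 1`), each `φᵢ` is unitarily equivalent to `φ`. -/
def IsCStarExtreme {A : Type*} [CStarAlgebra A] [PartialOrder A] [StarOrderedRing A]
    {H : Type*} [NormedAddCommGroup H] [InnerProductSpace ℂ H] [CompleteSpace H]
    (φ : CompletelyPositiveMap A (H →L[ℂ] H)) : Prop :=
  φ ∈ generalizedStateSpace A H ∧
    ∀ (n : ℕ) (ψ : Fin n → CompletelyPositiveMap A (H →L[ℂ] H)) (T : Fin n → (H →L[ℂ] H)),
      (∀ i, ψ i ∈ generalizedStateSpace A H) →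
      (∀ i, IsUnit (T i)) →
      ∑ i, star (T i) * T i = 1 →
      (∀ a, φ a = ∑ i, star (T i) * ψ i a * T i) →
      ∀ i, ∃ U ∈ unitary (H →L[ℂ] H), ∀ a, ψ i a = star U * φ a * U

/-- `(π, V, K)` is a minimal Stinespring triple for `φ`: `π` is a unital ⋆-representation of `A`
on the Hilbert space `K`, `φ(a) = V⋆ π(a) V`, and `π(A) V H` spans a dense subspace of `K`. -/
structure IsMinimalStinespringTriple {A : Type*} [CStarAlgebra A] [PartialOrder A]
    [StarOrderedRing A]
    {H : Type*} [NormedAddCommGroup H] [InnerProductSpace ℂ H] [CompleteSpace H]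
    {K : Type*} [NormedAddCommGroup K] [InnerProductSpace ℂ K] [CompleteSpace K]
    (φ : CompletelyPositiveMap A (H →L[ℂ] H)) (π : A →⋆ₐ[ℂ] (K →L[ℂ] K)) (V : H →L[ℂ] K) :
    Prop where
  apply_eq : ∀ a, φ a = V.adjoint ∘L π a ∘L V
  minimal : (Submodule.span ℂ {x : K | ∃ a h, x = π a (V h)}).topologicalClosure = ⊤

/-- The commutant `π(A)'` of the range of a representation, as a ⋆-subalgebra of the algebra of
bounded operators (the range of `π` is closed under `star`). -/
noncomputable def repCommutant {A : Type*} [CStarAlgebra A]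
    {K : Type*} [NormedAddCommGroup K] [InnerProductSpace ℂ K] [CompleteSpace K]
    (π : A →⋆ₐ[ℂ] (K →L[ℂ] K)) : StarSubalgebra ℂ (K →L[ℂ] K) :=
  StarSubalgebra.centralizer ℂ (Set.range π)

theorem mem_repCommutant_iff {A : Type*} [CStarAlgebra A]
    {K : Type*} [NormedAddCommGroup K] [InnerProductSpace ℂ K] [CompleteSpace K]
    (π : A →⋆ₐ[ℂ] (K →L[ℂ] K)) (T : K →L[ℂ] K) :
    T ∈ repCommutant π ↔ ∀ a, π a * T = T * π a := by
  rw [repCommutant, StarSubalgebra.mem_centralizer_iff]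
  constructor
  · intro h a
    exact (h (π a) ⟨a, rfl⟩).1
  · rintro h _ ⟨a, rfl⟩
    refine ⟨h a, ?_⟩
    rw [← map_star]
    exact h (star a)

/-- A (not necessarily self-adjoint) subalgebra `M` has factorization in the C⋆-algebra `B` (with
its order): every positive invertible `D` of `B` is `S⋆ S` for some invertible `S` of `B` with both
`S` and `S⁻¹` in `M`. -/
def HasFactorization {B : Type*} [Ring B] [StarRing B] [Algebra ℂ B] [PartialOrder B]
    (M : NonUnitalSubalgebra ℂ B) : Prop :=
  ∀ D : B, 0 ≤ D → IsUnit D →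
    ∃ S : Bˣ, (S : B) ∈ M ∧ ((S⁻¹ : Bˣ) : B) ∈ M ∧ D = star (S : B) * (S : B)

/-- The algebra `{T ∈ π(A)' | T V V⋆ = V V⋆ T V V⋆}`, as a subalgebra of `π(A)'`. -/
noncomputable def stinespringAlgebra {A : Type*} [CStarAlgebra A]
    {H : Type*} [NormedAddCommGroup H] [InnerProductSpace ℂ H] [CompleteSpace H]
    {K : Type*} [NormedAddCommGroup K] [InnerProductSpace ℂ K] [CompleteSpace K]
    (π : A →⋆ₐ[ℂ] (K →L[ℂ] K)) (V : H →L[ℂ] K) : NonUnitalSubalgebra ℂ (repCommutant π) where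
  carrier := {T | (T : K →L[ℂ] K) * (V ∘L V.adjoint) =
    (V ∘L V.adjoint) * (T : K →L[ℂ] K) * (V ∘L V.adjoint)}
  add_mem' {S T} hS hT := by
    simp only [Set.mem_ofPred_eq] at hS hT ⊢
    push_cast
    rw [add_mul, mul_add, add_mul, ← hS, ← hT]
  zero_mem' := by simp
  mul_mem' {S T} hS hT := by
    simp only [Set.mem_ofPred_eq] at hS hT ⊢
    push_cast
    generalize V ∘L V.adjoint = P at *
    calc (S : K →L[ℂ] K) * T * P = S * (P * T * P) := by rw [← hT, mul_assoc]
      _ = S * P * (T * P) := by simp only [mul_assoc]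
      _ = P * S * (P * T * P) := by rw [hS]; simp only [mul_assoc]
      _ = P * (S * T) * P := by rw [← hT]; simp only [mul_assoc]
  smul_mem' c {T} hT := by
    simp only [Set.mem_ofPred_eq] at hT ⊢
    push_cast
    rw [smul_mul_assoc, mul_smul_comm, smul_mul_assoc, ← hT]

/-! After scaling `D` so that `1 - D` is also strictly positive, `φ` splits as `V⋆ D π(·) V + V⋆ (1
- D) π(·) V`. Normalising each summand by a square root (`exists_ucp_of_isStrictlyPositive`) gives a
proper C⋆-convex combination, so extremality yields `V⋆ D π(·) V = T⋆ φ(·) T` with `T` invertible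
(`IsCStarExtreme.exists_isUnit`).

This says `⟪π(a)VTh, π(b)VTk⟫ = ⟪π(a)Vh, D π(b)Vk⟫`. By minimality, `π(a)Vh ↦ π(a)VTh` extends to an
invertible `S` in the commutant with `S⋆ S = D` and `S V = V T`
(`IsMinimalStinespringTriple.exists_intertwiner`). Hence `S` and `S⁻¹` preserve the range of `V`,
with compressions `T` and `T⁻¹`. -/

/-- A self-adjoint element `z` of a C⋆-algebra is nonnegative if no conjugate `n * z * n` of it by a
self-adjoint `n` is of the form `-c⋆ c` with `c ≠ 0`. -/
theorem IsSelfAdjoint.nonneg_of_conjugate {B : Type*} [CStarAlgebra B] [PartialOrder B]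
    [StarOrderedRing B] {z : B} (hz : IsSelfAdjoint z)
    (h : ∀ n c : B, IsSelfAdjoint n → n * z * n = -(star c * c) → c = 0) : 0 ≤ z := by
  rw [← CFC.negPart_eq_zero_iff z hz]
  have hn : 0 ≤ z⁻ := CFC.negPart_nonneg z
  obtain ⟨b, hb, hbn⟩ : ∃ b : B, IsSelfAdjoint b ∧ b * b = z⁻ :=
    ⟨CFC.sqrt z⁻, (CFC.sqrt_nonneg _).isSelfAdjoint, CFC.sqrt_mul_sqrt_self _ hn⟩
  have hs : star z⁻ = z⁻ := hn.isSelfAdjoint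
  -- Conjugating by `z⁻` kills `z⁺` and leaves `-(z⁻)³`.
  have key : z⁻ * z * z⁻ = -(star (b * z⁻) * (b * z⁻)) := by
    calc z⁻ * z * z⁻ = z⁻ * (z⁺ - z⁻) * z⁻ := by rw [CFC.posPart_sub_negPart z hz]
      _ = -(z⁻ * z⁻ * z⁻) := by rw [mul_sub, CFC.negPart_mul_posPart, zero_sub, neg_mul]
      _ = -(star (b * z⁻) * (b * z⁻)) := by
        rw [star_mul, hb.star_eq, hs, mul_assoc _ b, ← mul_assoc b b, hbn, mul_assoc]
  have h0 := h _ _ hn.isSelfAdjoint key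
  have h1 : star z⁻ * z⁻ = 0 := by
    calc star z⁻ * z⁻ = b * (b * z⁻) := by rw [hs, ← mul_assoc, hbn]
      _ = 0 := by rw [h0, mul_zero]
  exact CStarRing.star_mul_self_eq_zero_iff _ |>.1 h1

theorem CStarAlgebra.exists_eq_star_mul_self {B : Type*} [CStarAlgebra B] [PartialOrder B]
    [StarOrderedRing B] {z : B} (hz : 0 ≤ z) : ∃ b : B, z = star b * b :=
  CStarAlgebra.nonneg_iff_eq_star_mul_self.1 hz

/-! ### Positive operator matrices and compressions -/

section

variable {H K : Type*} [NormedAddCommGroup H] [InnerProductSpace ℂ H] [CompleteSpace H]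
  [NormedAddCommGroup K] [InnerProductSpace ℂ K] [CompleteSpace K]

theorem ContinuousLinearMap.adjoint_comp_self_nonneg (Y : H →L[ℂ] K) :
    0 ≤ (Y.adjoint ∘L Y : H →L[ℂ] H) :=
  (ContinuousLinearMap.nonneg_iff_isPositive _).2
    (ContinuousLinearMap.isPositive_adjoint_comp_self Y)

/-- The operator matrix `(Yᵢ⋆ Yⱼ)` summed over several rows of operators is nonnegative. -/
theorem CStarMatrix.nonneg_of_eq_sum_adjoint_comp {n m : Type*} [Fintype n] [Fintype m]
    [DecidableEq n]
    (Y : m → n → (H →L[ℂ] K)) (Z : CStarMatrix n n (H →L[ℂ] H))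
    (hZ : ∀ i j, Z i j = ∑ k, (Y k i).adjoint ∘L Y k j) : 0 ≤ Z := by
  have hsa : IsSelfAdjoint Z := by
    refine CStarMatrix.ext fun i j => ?_
    rw [CStarMatrix.star_apply, hZ, hZ, star_sum]
    refine Finset.sum_congr rfl fun k _ => ?_
    rw [ContinuousLinearMap.star_eq_adjoint, ContinuousLinearMap.adjoint_comp,
      ContinuousLinearMap.adjoint_adjoint]
  refine hsa.nonneg_of_conjugate fun N c hN hc => ?_
  have hNij : ∀ i j, star (N j i) = N i j := fun i j => by
    rw [← CStarMatrix.star_apply, hN.star_eq]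
  -- Diagonals suffice: those of `N Z N` are sums of `R⋆ R`, those of `-(c⋆ c)` are nonpositive, so
  -- every column of `c` vanishes.
  have hdiag : ∀ i, 0 ≤ (N * Z * N) i i := by
    intro i
    have : (N * Z * N) i i =
        ∑ k, (∑ j, Y k j ∘L N j i).adjoint ∘L (∑ j, Y k j ∘L N j i) := by
      simp only [CStarMatrix.mul_apply, hZ, map_sum, ContinuousLinearMap.adjoint_comp]
      simp only [← ContinuousLinearMap.star_eq_adjoint (N _ _), hNij, Finset.mul_sum,
        Finset.sum_mul, ContinuousLinearMap.mul_def]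
      ext x
      simp only [_root_.sum_apply, ContinuousLinearMap.comp_apply, map_sum]
      rw [Finset.sum_comm_cycle]
    rw [this]
    exact Finset.sum_nonneg fun k _ => ContinuousLinearMap.adjoint_comp_self_nonneg _
  refine CStarMatrix.ext fun j i => ?_
  have hsum : (star c * c) i i = ∑ k, star (c k i) * c k i := by
    simp only [CStarMatrix.mul_apply, CStarMatrix.star_apply]
  have h0 : ∑ k, star (c k i) * c k i = 0 := by
    refine le_antisymm ?_ (Finset.sum_nonneg fun k _ => star_mul_self_nonneg _)
    have := hdiag i
    rw [hc, CStarMatrix.neg_apply, hsum] at this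
    exact neg_nonneg.1 this
  have := (Finset.sum_eq_zero_iff_of_nonneg fun k _ => star_mul_self_nonneg (c k i)).1 h0 j
    (Finset.mem_univ j)
  exact CStarRing.star_mul_self_eq_zero_iff _ |>.1 this

/-- The completely positive map `a ↦ R⋆ π(a) R` compressing a representation by a bounded
operator. -/
noncomputable def CompletelyPositiveMap.ofRepresentation {A : Type*} [CStarAlgebra A]
    [PartialOrder A] [StarOrderedRing A] (π : A →⋆ₐ[ℂ] (K →L[ℂ] K)) (R : H →L[ℂ] K) :
    CompletelyPositiveMap A (H →L[ℂ] H) where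
  toFun a := R.adjoint ∘L π a ∘L R
  map_add' a b := by ext; simp
  map_smul' c a := by ext; simp
  map_cstarMatrix_nonneg' k M hM := by
    obtain ⟨X, rfl⟩ := CStarAlgebra.exists_eq_star_mul_self hM
    refine CStarMatrix.nonneg_of_eq_sum_adjoint_comp (fun l i => π (X l i) ∘L R) _ fun i j => ?_
    ext x
    simp [CStarMatrix.mul_apply, CStarMatrix.star_apply, ContinuousLinearMap.adjoint_comp,
      map_star, ContinuousLinearMap.star_eq_adjoint]

theorem CompletelyPositiveMap.ofRepresentation_apply {A : Type*} [CStarAlgebra A]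
    [PartialOrder A] [StarOrderedRing A] (π : A →⋆ₐ[ℂ] (K →L[ℂ] K)) (R : H →L[ℂ] K) (a : A) :
    CompletelyPositiveMap.ofRepresentation π R a = R.adjoint ∘L π a ∘L R := rfl

theorem IsStrictlyPositive.exists_smul_one_le {D : K →L[ℂ] K} (hD : IsStrictlyPositive D) :
    ∃ r : ℝ, 0 < r ∧ r • (1 : K →L[ℂ] K) ≤ D := by
  rcases subsingleton_or_nontrivial (K →L[ℂ] K) with h | h
  · exact ⟨1, one_pos, (Subsingleton.elim _ _).le⟩
  · obtain ⟨r, hr, h⟩ := (CFC.exists_pos_algebraMap_le_iff hD.isSelfAdjoint).2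
      fun x hx => hD.spectrum_pos hx
    exact ⟨r, hr, by rwa [← Algebra.algebraMap_eq_smul_one]⟩

theorem isStrictlyPositive_smul_one {r : ℝ} (hr : 0 < r) :
    IsStrictlyPositive (r • (1 : H →L[ℂ] H)) :=
  ⟨smul_nonneg hr.le zero_le_one, by
    rw [← Algebra.algebraMap_eq_smul_one]
    exact (IsUnit.mk0 r hr.ne').map _⟩

theorem ContinuousLinearMap.adjoint_conj_mono (V : H →L[ℂ] K) {C D : K →L[ℂ] K} (h : C ≤ D) :
    V.adjoint ∘L C ∘L V ≤ V.adjoint ∘L D ∘L V := by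
  rw [ContinuousLinearMap.le_def] at h ⊢
  have := h.adjoint_conj V
  rwa [ContinuousLinearMap.sub_comp, ContinuousLinearMap.comp_sub] at this

/-- Since `V` is an isometry, a lower bound `r ≤ D` compresses to `r ≤ V⋆ D V`. -/
theorem IsStrictlyPositive.adjoint_conj {V : H →L[ℂ] K} (hV : V.adjoint ∘L V = 1)
    {D : K →L[ℂ] K} (hD : IsStrictlyPositive D) : IsStrictlyPositive (V.adjoint ∘L D ∘L V) := by
  obtain ⟨r, hr, h⟩ := hD.exists_smul_one_le
  refine (isStrictlyPositive_smul_one hr).of_le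
    (le_trans (le_of_eq ?_) (V.adjoint_conj_mono h))
  rw [← hV]
  ext x
  simp

end

open scoped InnerProductSpace

/-! ### Extremality and the intertwining operator -/

section

variable {A : Type*} [CStarAlgebra A] [PartialOrder A] [StarOrderedRing A]
  {H K : Type*} [NormedAddCommGroup H] [InnerProductSpace ℂ H] [CompleteSpace H]
  [NormedAddCommGroup K] [InnerProductSpace ℂ K] [CompleteSpace K]

/-- A positive invertible `D` in the commutant of `π` yields a unital completely positive map
`T⁻¹ V⋆ D π(·) V T⁻¹` with `T = (V⋆ D V) ^ (1/2)`. -/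
theorem exists_ucp_of_isStrictlyPositive (π : A →⋆ₐ[ℂ] (K →L[ℂ] K)) {V : H →L[ℂ] K}
    (hV : V.adjoint ∘L V = 1) {D : K →L[ℂ] K} (hDπ : D ∈ repCommutant π)
    (hD : IsStrictlyPositive D) :
    ∃ (ψ : CompletelyPositiveMap A (H →L[ℂ] H)) (T : H →L[ℂ] H),
      ψ ∈ generalizedStateSpace A H ∧ IsUnit T ∧ star T * T = V.adjoint ∘L D ∘L V ∧
        ∀ a, star T * ψ a * T = V.adjoint ∘L (D * π a) ∘L V := by
  have hE : IsStrictlyPositive (V.adjoint ∘L D ∘L V) := hD.adjoint_conj hV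
  obtain ⟨T, hTs, hTT⟩ : ∃ T : (H →L[ℂ] H)ˣ, star (T : H →L[ℂ] H) = T ∧
      (T : H →L[ℂ] H) * T = V.adjoint ∘L D ∘L V := by
    obtain ⟨T, hT⟩ := hE.isUnit_cfcSqrt
    exact ⟨T, by rw [hT]; exact (CFC.sqrt_nonneg _).isSelfAdjoint,
      by rw [hT]; exact CFC.sqrt_mul_sqrt_self _ hE.nonneg⟩
  -- The square root `G` of `D` also commutes with `π`, so `V⋆ D π(a) V = (G V)⋆ π(a) (G V)`,
  -- visibly completely positive.
  obtain ⟨G, hG, hGG, hGπ⟩ : ∃ G : K →L[ℂ] K, G.adjoint = G ∧ G * G = D ∧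
      ∀ a, G * π a = π a * G := by
    refine ⟨CFC.sqrt D, (CFC.sqrt_nonneg _).isSelfAdjoint, CFC.sqrt_mul_sqrt_self _ hD.nonneg,
      fun a => ?_⟩
    have : Commute D (π a) := ((mem_repCommutant_iff π D).1 hDπ a).symm
    exact this.cfcₙ_nnreal _
  have key : ∀ a, star (T : H →L[ℂ] H) *
      CompletelyPositiveMap.ofRepresentation π (G ∘L V ∘L ((T⁻¹ : (H →L[ℂ] H)ˣ) : H →L[ℂ] H)) a *
      T = V.adjoint ∘L (D * π a) ∘L V := by
    intro a
    have h1 : (T : H →L[ℂ] H) ∘L (((T⁻¹ : (H →L[ℂ] H)ˣ) : H →L[ℂ] H)).adjoint = 1 := by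
      rw [← hTs, ← ContinuousLinearMap.star_eq_adjoint, ← ContinuousLinearMap.mul_def, ← star_mul,
        Units.inv_mul, star_one]
    have h2 : ((T⁻¹ : (H →L[ℂ] H)ˣ) : H →L[ℂ] H) ∘L (T : H →L[ℂ] H) = 1 := T.inv_mul
    rw [hTs, CompletelyPositiveMap.ofRepresentation_apply, ContinuousLinearMap.adjoint_comp,
      ContinuousLinearMap.adjoint_comp, hG, ← hGG, mul_assoc G G, hGπ]
    ext x
    have h1' := fun y => DFunLike.congr_fun h1 y
    have h2' := fun y => DFunLike.congr_fun h2 y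
    simp only [ContinuousLinearMap.comp_apply, mul_apply_eq_comp,
      one_apply_eq_self] at h1' h2' ⊢
    rw [h1', h2']
  refine ⟨_, T, ?_, T.isUnit, by rw [hTs, hTT], key⟩
  -- At `a = 1` the identity reads `T ψ(1) T = T T`; cancelling `T` on both sides gives unitality.
  have := key 1
  rw [map_one π, mul_one, ← hTT, hTs] at this
  have h3 := T.mul_right_inj.1 ((mul_assoc _ _ _).symm.trans this)
  exact T.mul_left_inj.1 (h3.trans (one_mul _).symm)

theorem IsMinimalStinespringTriple.adjoint_comp_self
    {φ : CompletelyPositiveMap A (H →L[ℂ] H)} {π : A →⋆ₐ[ℂ] (K →L[ℂ] K)} {V : H →L[ℂ] K}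
    (h : IsMinimalStinespringTriple φ π V) (hφ : φ ∈ generalizedStateSpace A H) :
    V.adjoint ∘L V = 1 := by
  have h1 : φ 1 = 1 := hφ
  rw [h.apply_eq, map_one] at h1
  exact h1

/-- C⋆-extremality, tested against the decomposition `1 = D + C` in the commutant. -/
theorem IsCStarExtreme.exists_isUnit_of_add_eq_one
    {φ : CompletelyPositiveMap A (H →L[ℂ] H)} (hφ : IsCStarExtreme φ)
    {π : A →⋆ₐ[ℂ] (K →L[ℂ] K)} {V : H →L[ℂ] K} (hπV : IsMinimalStinespringTriple φ π V)
    {D C : K →L[ℂ] K} (hDπ : D ∈ repCommutant π) (hCπ : C ∈ repCommutant π)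
    (hD : IsStrictlyPositive D) (hC : IsStrictlyPositive C) (hDC : D + C = 1) :
    ∃ T : H →L[ℂ] H, IsUnit T ∧
      ∀ a, V.adjoint ∘L (D * π a) ∘L V = star T * φ a * T := by
  have hV := hπV.adjoint_comp_self hφ.1
  obtain ⟨ψ₁, T₁, hψ₁, hT₁, hs₁, h₁⟩ := exists_ucp_of_isStrictlyPositive π hV hDπ hD
  obtain ⟨ψ₂, T₂, hψ₂, hT₂, hs₂, h₂⟩ := exists_ucp_of_isStrictlyPositive π hV hCπ hC
  have hadd : ∀ X : K →L[ℂ] K, V.adjoint ∘L (D * X) ∘L V + V.adjoint ∘L (C * X) ∘L V =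
      V.adjoint ∘L X ∘L V := fun X => by
    rw [← ContinuousLinearMap.comp_add, ← ContinuousLinearMap.add_comp, ← add_mul, hDC, one_mul]
  obtain ⟨U, hU, hψ⟩ := hφ.2 2 ![ψ₁, ψ₂] ![T₁, T₂] (by simp [Fin.forall_fin_two, hψ₁, hψ₂])
    (by simp [Fin.forall_fin_two, hT₁, hT₂])
    (by
      have := hadd 1
      simp only [mul_one] at this
      simp only [Fin.sum_univ_two, Matrix.cons_val_zero, Matrix.cons_val_one, hs₁, hs₂, this]
      exact hV)
    (fun a => by
      simp only [Fin.sum_univ_two, Matrix.cons_val_zero, Matrix.cons_val_one, h₁, h₂, hadd]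
      exact hπV.apply_eq a) 0
  refine ⟨U * T₁, (Unitary.isUnit_coe (U := ⟨U, hU⟩)).mul hT₁, fun a => ?_⟩
  have h := hψ a
  simp only [Matrix.cons_val_zero] at h
  rw [← h₁, h, star_mul]
  simp only [mul_assoc]

/-- The conclusion is homogeneous in `D`: shrink `D` by `r` until `1 - r D` is strictly positive,
then divide the resulting `T` by `√r`. -/
theorem IsCStarExtreme.exists_isUnit
    {φ : CompletelyPositiveMap A (H →L[ℂ] H)} (hφ : IsCStarExtreme φ)
    {π : A →⋆ₐ[ℂ] (K →L[ℂ] K)} {V : H →L[ℂ] K} (hπV : IsMinimalStinespringTriple φ π V)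
    {D : K →L[ℂ] K} (hDπ : D ∈ repCommutant π) (hD : IsStrictlyPositive D) :
    ∃ T : H →L[ℂ] H, IsUnit T ∧
      ∀ a, V.adjoint ∘L (D * π a) ∘L V = star T * φ a * T := by
  obtain ⟨r, hr, hrD⟩ : ∃ r : ℝ, 0 < r ∧ r * ‖D‖ < 1 := by
    have hpos : 0 < ‖D‖ + 1 := by positivity
    exact ⟨(‖D‖ + 1)⁻¹, inv_pos.2 hpos, by
      rw [inv_mul_lt_iff₀ hpos]; linarith⟩
  have hmem : ((r : ℂ) • D) ∈ repCommutant π := SMulMemClass.smul_mem _ hDπ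
  have hDr : IsStrictlyPositive ((r : ℂ) • D) := by
    refine ⟨by rw [Complex.coe_smul]; exact smul_nonneg hr.le hD.nonneg, ?_⟩
    rw [← smul_one_mul, ← Algebra.algebraMap_eq_smul_one]
    exact ((IsUnit.mk0 (r : ℂ) (by exact_mod_cast hr.ne')).map _).mul hD.isUnit
  have hC : IsStrictlyPositive (1 - (r : ℂ) • D) := by
    refine (isStrictlyPositive_smul_one (sub_pos.2 hrD)).of_le ?_
    have : D ≤ ‖D‖ • (1 : K →L[ℂ] K) := by
      rw [← Algebra.algebraMap_eq_smul_one]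
      exact hD.isSelfAdjoint.le_algebraMap_norm_self
    rw [sub_smul, one_smul, Complex.coe_smul, mul_smul]
    exact sub_le_sub_left (smul_le_smul_of_nonneg_left this hr.le) _
  obtain ⟨T, hT, h⟩ := hφ.exists_isUnit_of_add_eq_one hπV hmem
    (sub_mem (one_mem _) hmem) hDr hC (add_sub_cancel _ _)
  have hs : ((Real.sqrt r : ℝ) : ℂ) ≠ 0 := by exact_mod_cast (Real.sqrt_pos.2 hr).ne'
  refine ⟨((Real.sqrt r : ℝ) : ℂ)⁻¹ • T, ?_, fun a => ?_⟩
  · rw [← smul_one_mul, ← Algebra.algebraMap_eq_smul_one]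
    exact ((IsUnit.mk0 _ (inv_ne_zero hs)).map _).mul hT
  · have hrr : ((Real.sqrt r : ℝ) : ℂ)⁻¹ * ((Real.sqrt r : ℝ) : ℂ)⁻¹ = (r : ℂ)⁻¹ := by
      rw [← mul_inv, ← Complex.ofReal_mul, Real.mul_self_sqrt hr.le]
    have hr' : (r : ℂ) ≠ 0 := by exact_mod_cast hr.ne'
    have h' := h a
    rw [star_smul, smul_mul_assoc, smul_mul_assoc, mul_smul_comm, smul_smul, ← h', star_inv₀,
      Complex.star_def, Complex.conj_ofReal, hrr, smul_mul_assoc]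
    ext x
    simp only [ContinuousLinearMap.comp_apply, _root_.smul_apply, map_smul, smul_smul,
      inv_mul_cancel₀ hr', one_smul]

/-- Intertwining operator: if `V⋆ D π(·) V = T⋆ V⋆ π(·) V T` with `T` invertible and `D` positive
and invertible in the commutant of `π`, then `D = S⋆ S` for an invertible `S` in the commutant with
`S V = V T`. -/
theorem IsMinimalStinespringTriple.exists_intertwiner
    {φ : CompletelyPositiveMap A (H →L[ℂ] H)} {π : A →⋆ₐ[ℂ] (K →L[ℂ] K)} {V : H →L[ℂ] K}
    (hπV : IsMinimalStinespringTriple φ π V) {D : K →L[ℂ] K} (hDπ : D ∈ repCommutant π)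
    (hD : IsStrictlyPositive D) (T : (H →L[ℂ] H)ˣ)
    (hT : ∀ a, V.adjoint ∘L (D * π a) ∘L V = star (T : H →L[ℂ] H) * φ a * T) :
    ∃ S : (K →L[ℂ] K)ˣ, (S : K →L[ℂ] K) ∈ repCommutant π ∧
      D = star (S : K →L[ℂ] K) * S ∧ (S : K →L[ℂ] K) ∘L V = V ∘L (T : H →L[ℂ] H) := by
  have hDc := (mem_repCommutant_iff π D).1 hDπ
  -- On formal combinations both maps are defined outright; well-definedness of `e x ↦ f x` will
  -- follow from norm bounds.
  let e : (A × H →₀ ℂ) →ₗ[ℂ] K := Finsupp.linearCombination ℂ fun p => π p.1 (V p.2)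
  let f : (A × H →₀ ℂ) →ₗ[ℂ] K := Finsupp.linearCombination ℂ fun p => π p.1 (V (T.val p.2))
  have he1 : ∀ a h, e (Finsupp.single (a, h) 1) = π a (V h) := fun a h => by
    simp [e]
  have hf1 : ∀ a h, f (Finsupp.single (a, h) 1) = π a (V (T.val h)) := fun a h => by
    simp [f]
  have hrange : ∀ g : H → H, Function.Surjective g →
      DenseRange (Finsupp.linearCombination ℂ fun p : A × H => π p.1 (V (g p.2))) := by
    intro g hg
    have : Set.range (fun p : A × H => π p.1 (V (g p.2))) =
        {x : K | ∃ a h, x = π a (V h)} := by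
      ext x
      constructor
      · rintro ⟨p, rfl⟩
        exact ⟨_, _, rfl⟩
      · rintro ⟨a, h, rfl⟩
        obtain ⟨k, rfl⟩ := hg h
        exact ⟨(a, k), rfl⟩
    rw [DenseRange, ← LinearMap.coe_range, Finsupp.range_linearCombination, this]
    exact (Submodule.dense_iff_topologicalClosure_eq_top).2 hπV.minimal
  have he : DenseRange e := hrange id Function.surjective_id
  have hTsurj : Function.Surjective T.val := fun h => ⟨(T⁻¹).val h, by
    rw [← mul_apply_eq_comp, T.mul_inv, one_apply_eq_self]⟩
  have hf : DenseRange f := hrange T.val hTsurj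
  have hbasic : ∀ a h b k, ⟪π a (V (T.val h)), π b (V (T.val k))⟫_ℂ =
      ⟪π a (V h), D (π b (V k))⟫_ℂ := by
    intro a h b k
    have h1 := DFunLike.congr_fun (hT (star a * b)) k
    rw [hπV.apply_eq] at h1
    have h2 := congrArg (fun x => ⟪h, x⟫_ℂ) h1
    simp only [mul_apply_eq_comp, ContinuousLinearMap.comp_apply, map_mul, map_star,
      ContinuousLinearMap.star_eq_adjoint, ContinuousLinearMap.adjoint_inner_right] at h2
    rw [← h2, ← ContinuousLinearMap.star_eq_adjoint, ← map_star,
      ← mul_apply_eq_comp D, ← hDc, mul_apply_eq_comp, map_star,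
      ContinuousLinearMap.star_eq_adjoint, ContinuousLinearMap.adjoint_inner_right]
  have hinner : ∀ x y, ⟪f x, f y⟫_ℂ = ⟪e x, D (e y)⟫_ℂ := by
    intro x y
    simp only [e, f, Finsupp.linearCombination_apply, Finsupp.sum, map_sum, sum_inner, inner_sum,
      map_smul, inner_smul_left, inner_smul_right, hbasic]
  -- By `hinner`, `r ≤ D ≤ ‖D‖` makes the norms of `e x` and `f x` comparable: the upper bound gives
  -- `S`, the lower bound its inverse.
  obtain ⟨r, hr, hrD⟩ := hD.exists_smul_one_le
  have hfe : ∀ x, ‖f x‖ ≤ Real.sqrt ‖D‖ * ‖e x‖ := by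
    intro x
    refine le_of_sq_le_sq ?_ (by positivity)
    rw [mul_pow, Real.sq_sqrt (norm_nonneg _), ← inner_self_eq_norm_sq (𝕜 := ℂ), hinner]
    calc RCLike.re ⟪e x, D (e x)⟫_ℂ ≤ ‖e x‖ * ‖D (e x)‖ := re_inner_le_norm _ _
      _ ≤ ‖e x‖ * (‖D‖ * ‖e x‖) := by gcongr; exact D.le_opNorm _
      _ = ‖D‖ * ‖e x‖ ^ 2 := by ring
  have hef : ∀ x, ‖e x‖ ≤ (Real.sqrt r)⁻¹ * ‖f x‖ := by
    intro x
    have hs := Real.sqrt_pos.2 hr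
    rw [le_inv_mul_iff₀ hs]
    refine le_of_sq_le_sq ?_ (norm_nonneg _)
    rw [mul_pow, Real.sq_sqrt hr.le, ← inner_self_eq_norm_sq (𝕜 := ℂ) (f x), hinner]
    have := ((ContinuousLinearMap.le_def _ _).1 hrD).re_inner_nonneg_right (e x)
    rw [_root_.sub_apply, inner_sub_right, map_sub, sub_nonneg] at this
    refine le_trans (le_of_eq ?_) this
    rw [_root_.smul_apply, one_apply_eq_self, ← Complex.coe_smul,
      inner_smul_right, ← inner_self_eq_norm_sq (𝕜 := ℂ) (e x)]
    simp
  have hS : ∀ x, f.extendOfNorm e (e x) = f x := LinearMap.extendOfNorm_eq he ⟨_, hfe⟩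
  have hR : ∀ x, e.extendOfNorm f (f x) = e x := LinearMap.extendOfNorm_eq hf ⟨_, hef⟩
  have ext_e : ∀ {X Y : K →L[ℂ] K}, (∀ x, X (e x) = Y (e x)) → X = Y := fun {X Y} h =>
    DFunLike.coe_injective (he.equalizer X.continuous Y.continuous (funext h))
  have ext_f : ∀ {X Y : K →L[ℂ] K}, (∀ x, X (f x) = Y (f x)) → X = Y := fun {X Y} h =>
    DFunLike.coe_injective (hf.equalizer X.continuous Y.continuous (funext h))
  let S : (K →L[ℂ] K)ˣ := ⟨f.extendOfNorm e, e.extendOfNorm f,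
    ext_f fun x => by simp [hS, hR], ext_e fun x => by simp [hS, hR]⟩
  have hSv : ∀ a h, S.val (π a (V h)) = π a (V (T.val h)) := fun a h => by
    rw [← he1, ← hf1]
    exact hS _
  refine ⟨S, (mem_repCommutant_iff π _).2 fun a => ext_e fun x => ?_, ext_e fun y => ?_, ?_⟩
  · simp only [e, Finsupp.linearCombination_apply, Finsupp.sum, map_sum, map_smul,
      mul_apply_eq_comp, hSv]
    refine Finset.sum_congr rfl fun p _ => ?_
    rw [← mul_apply_eq_comp, ← map_mul, ← hSv, map_mul π,
      mul_apply_eq_comp]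
  -- The vectors `e y` are already dense in the right slot; density in the left slot reduces `D = S⋆
  -- S` to `hinner`.
  · refine ext_inner_left ℂ fun v => congrFun (he.equalizer (g := fun v => ⟪v, D (e y)⟫_ℂ)
      (h := fun v => ⟪v, (star S.val * S.val) (e y)⟫_ℂ) (by fun_prop) (by fun_prop)
      (funext fun x => ?_)) v
    have h3 : S.val (e x) = f x := hS x
    have h4 : S.val (e y) = f y := hS y
    simp only [Function.comp_apply]
    rw [mul_apply_eq_comp, ContinuousLinearMap.star_eq_adjoint,
      ContinuousLinearMap.adjoint_inner_right, h3, h4, hinner]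
  · ext h
    have := hSv 1 h
    simpa using this

end

/-! ### The factorization theorem -/

theorem mainTheorem5 {A : Type*} [CStarAlgebra A] [PartialOrder A] [StarOrderedRing A]
    {H : Type*} [NormedAddCommGroup H] [InnerProductSpace ℂ H] [CompleteSpace H]
    [TopologicalSpace.SeparableSpace H]
    {K : Type*} [NormedAddCommGroup K] [InnerProductSpace ℂ K] [CompleteSpace K]
    (φ : CompletelyPositiveMap A (H →L[ℂ] H)) (hφ : IsCStarExtreme φ)
    (π : A →⋆ₐ[ℂ] (K →L[ℂ] K)) (V : H →L[ℂ] K) (hπV : IsMinimalStinespringTriple φ π V) :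
    (∀ D : K →L[ℂ] K, D ∈ repCommutant π → 0 ≤ D → IsUnit D →
      ∃ S : (K →L[ℂ] K)ˣ,
        (S : K →L[ℂ] K) ∈ repCommutant π ∧
        ((S⁻¹ : (K →L[ℂ] K)ˣ) : K →L[ℂ] K) ∈ repCommutant π ∧
        D = star (S : K →L[ℂ] K) * (S : K →L[ℂ] K) ∧
        (S : K →L[ℂ] K) * (V ∘L V.adjoint) =
          (V ∘L V.adjoint) * (S : K →L[ℂ] K) * (V ∘L V.adjoint) ∧
        (V.adjoint ∘L (S : K →L[ℂ] K) ∘L V) *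
          (V.adjoint ∘L ((S⁻¹ : (K →L[ℂ] K)ˣ) : K →L[ℂ] K) ∘L V) = 1 ∧
        (V.adjoint ∘L ((S⁻¹ : (K →L[ℂ] K)ˣ) : K →L[ℂ] K) ∘L V) *
          (V.adjoint ∘L (S : K →L[ℂ] K) ∘L V) = 1) ∧
    HasFactorization (stinespringAlgebra π V) := by
  have hV := hπV.adjoint_comp_self hφ.1
  have hVx : ∀ x, V.adjoint (V x) = x := fun x => DFunLike.congr_fun hV x
  have main : ∀ D : K →L[ℂ] K, D ∈ repCommutant π → 0 ≤ D → IsUnit D →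
      ∃ (S : (K →L[ℂ] K)ˣ) (T : (H →L[ℂ] H)ˣ),
        (S : K →L[ℂ] K) ∈ repCommutant π ∧
        ((S⁻¹ : (K →L[ℂ] K)ˣ) : K →L[ℂ] K) ∈ repCommutant π ∧
        D = star (S : K →L[ℂ] K) * (S : K →L[ℂ] K) ∧
        (∀ x, S.val (V x) = V (T.val x)) ∧ ∀ x, S⁻¹.val (V x) = V (T⁻¹.val x) := by
    intro D hDπ hD0 hDu
    obtain ⟨T, ⟨T, rfl⟩, hT⟩ := hφ.exists_isUnit hπV hDπ ⟨hD0, hDu⟩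
    obtain ⟨S, hSπ, hDS, hSV⟩ := hπV.exists_intertwiner hDπ ⟨hD0, hDu⟩ T hT
    have hSx : ∀ x, S.val (V x) = V (T.val x) := fun x => DFunLike.congr_fun hSV x
    refine ⟨S, T, hSπ, (mem_repCommutant_iff π _).2 fun a => ?_, hDS, hSx, fun x => ?_⟩
    · have h : Commute (π a) S.val := (mem_repCommutant_iff π _).1 hSπ a
      exact h.units_inv_right
    -- Applying `S⁻¹` to `V x = S V T⁻¹ x` transfers the intertwining relation to the inverses.
    · have h1 : T.val (T⁻¹.val x) = x := DFunLike.congr_fun T.mul_inv x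
      have h2 := hSx (T⁻¹.val x)
      rw [h1] at h2
      rw [← h2]
      exact DFunLike.congr_fun S.inv_mul _
  refine ⟨fun D hDπ hD0 hDu => ?_, fun D hD0 hDu => ?_⟩
  · obtain ⟨S, T, hSπ, hSπ', hDS, hSV, hSV'⟩ := main D hDπ hD0 hDu
    refine ⟨S, hSπ, hSπ', hDS, ?_, ?_, ?_⟩
    · ext x
      simp [hSV, hVx]
    · ext x
      simp only [mul_apply_eq_comp, ContinuousLinearMap.comp_apply, hSV, hSV', hVx]
      exact DFunLike.congr_fun T.mul_inv x
    · ext x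
      simp only [mul_apply_eq_comp, ContinuousLinearMap.comp_apply, hSV, hSV', hVx]
      exact DFunLike.congr_fun T.inv_mul x
  · obtain ⟨S, T, hSπ, hSπ', hDS, hSV, hSV'⟩ :=
      main D D.2 hD0 (hDu.map (repCommutant π).subtype)
    refine ⟨⟨⟨S, hSπ⟩, ⟨S⁻¹.val, hSπ'⟩, Subtype.ext S.mul_inv, Subtype.ext S.inv_mul⟩, ?_, ?_,
      Subtype.ext hDS⟩
    · change S.val * (V ∘L V.adjoint) = (V ∘L V.adjoint) * S.val * (V ∘L V.adjoint)
      ext x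
      simp [hSV, hVx]
    · change S⁻¹.val * (V ∘L V.adjoint) = (V ∘L V.adjoint) * S⁻¹.val * (V ∘L V.adjoint)
      ext x
      simp only [mul_apply_eq_comp, ContinuousLinearMap.comp_apply, hSV', hVx]
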